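/- Let $K$ be a field and let $G$ be a finite simple graph with vertex set $V(G)=\{v_1,\dots,v_n\}$. Let $I(G)\subseteq S=K[x_1,\dots,x_n]$ be its edge ideal, i.e. the ideal generated by all monomials $x_ix_j$ with $\{v_i,v_j\}\in E(G)$. A monomial ideal $J\subseteq S$ is said to have a linear resolution if there is an integer $d$ such that $\beta_{i,i+t}(J)=0$ for all $i\ge 0$ and all $t\neq d$. Here $\beta_{i,j}(J)$ is the $i$-th $\mathbb{Z}$-graded Betti number of $J$ in degree $j$, that is, the number of basis elements of total degree $j$ in the $i$-th module $F_i$ of a minimal $\mathbb{Z}^n$-graded free resolution $0\to F_p\to\cdots\to F_1\to F_0\to J\to 0$. If $I(G)^s$ has a linear resolution for some integer $s\ge 1$, then the complementary graph $G^c$ (same vertex set; two distinct vertices are adjacent in $G^c$ if and only if they are not adjacent in $G$) has no induced $4$-cycle. -/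

import Mathlib

open MvPolynomial

/-- `p` lies in the graded piece of multidegree `a ∈ ℤ^σ` of the polynomial ring: every monomial
of `p` has exponent vector `a`. (The only such `p` is `0` if `a` has a negative entry.) -/
def IsMultihomogeneous {σ K : Type*} [CommSemiring K]
    (p : MvPolynomial σ K) (a : σ → ℤ) : Prop :=
  ∀ m ∈ p.support, ∀ v, (m v : ℤ) = a v

/-- A finite `ℤ^σ`-graded free resolution `0 → F_p → ⋯ → F_1 → F_0 → I → 0` of an ideal `I` of the
polynomial ring `S = K[x_v : v ∈ σ]`. The module `F_i` is `⊕_b S(-deg i b)`, free on finitely many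
basis elements `b`, the basis element `b` being homogeneous of multidegree `deg i b`. -/
structure MultigradedFreeResolution {σ K : Type*} [Field K] (I : Ideal (MvPolynomial σ K)) where
  /-- the length `p`, a bound beyond which the `F_i` vanish -/
  length : ℕ
  /-- the number of basis elements of `F_i` -/
  rank : ℕ → ℕ
  rank_eq_zero : ∀ i, length < i → rank i = 0
  /-- the multidegrees of the basis elements of `F_i` -/
  deg : (i : ℕ) → Fin (rank i) → σ → ℤ
  /-- the augmentation `F_0 → I` -/
  aug : (Fin (rank 0) → MvPolynomial σ K) →ₗ[MvPolynomial σ K] I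
  /-- the differential `F_{i+1} → F_i` -/
  d : (i : ℕ) → (Fin (rank (i + 1)) → MvPolynomial σ K) →ₗ[MvPolynomial σ K]
    (Fin (rank i) → MvPolynomial σ K)
  /-- the augmentation is graded -/
  aug_graded : ∀ b, IsMultihomogeneous (aug (Pi.single b 1) : MvPolynomial σ K) (deg 0 b)
  /-- the differentials are graded -/
  d_graded : ∀ i b c, IsMultihomogeneous (d i (Pi.single b 1) c) (deg (i + 1) b - deg i c)
  aug_surjective : Function.Surjective aug
  exact_zero : Function.Exact (d 0) aug
  exact_succ : ∀ i, Function.Exact (d (i + 1)) (d i)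

namespace MultigradedFreeResolution

variable {σ K : Type*} [Field K] {I : Ideal (MvPolynomial σ K)}

/-- The resolution is minimal: in every homological degree the number of basis elements is the
least possible one among all multigraded free resolutions of `I`. -/
def IsMinimal (F : MultigradedFreeResolution I) : Prop :=
  ∀ (F' : MultigradedFreeResolution I) (i : ℕ), F.rank i ≤ F'.rank i

/-- For a minimal resolution, the `i`-th `ℤ`-graded Betti number `β_{i,j}(I)`: the number of basis
elements of `F_i` whose multidegree `a` has `|a| = j`, that is, the sum of the multigraded Betti
numbers `β_{i,a}(I)` over all `a` with `|a| = j`. -/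
def betti [Fintype σ] (F : MultigradedFreeResolution I) (i : ℕ) (j : ℤ) : ℕ :=
  (Finset.univ.filter fun b : Fin (F.rank i) => ∑ v, F.deg i b v = j).card

end MultigradedFreeResolution

/-- `I` has a linear resolution: there is an integer `d` such that `β_{i,i+t}(I) = 0` for all `i`
and all `t ≠ d`, the Betti numbers being read off a minimal multigraded free resolution of `I`. -/
def HasLinearResolution {σ K : Type*} [Fintype σ] [Field K]
    (I : Ideal (MvPolynomial σ K)) : Prop :=
  ∃ F : MultigradedFreeResolution I, F.IsMinimal ∧
    ∃ d : ℤ, ∀ (i : ℕ) (t : ℤ), t ≠ d → F.betti i (i + t) = 0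

/-- The edge ideal of a graph `G` over `K`, generated by the monomials `x_v x_w` for the edges
`{v, w}` of `G`. -/
noncomputable def edgeIdeal (K : Type*) [Field K] {V : Type*} (G : SimpleGraph V) :
    Ideal (MvPolynomial V K) :=
  Ideal.span {p | ∃ v w, G.Adj v w ∧ p = X v * X w}

/-! An induced 4-cycle of the complement is a pair of edges ab, xy of G with no edge between them.
Put u = ab, w = xy. The generators u^s and u^(s-1)w of I(G)^s have the syzygy w[u^s] - u[u^(s-1)w].
In a linear resolution it is a combination of linear syzygies, and its coefficient w on [u^s] can
only come from those with x or y there. These live in multidegree u^s x or u^s y, where u^s is the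
only generator of degree 2s dividing the multidegree, so their u^s component cancels
(`sum_coeff_aug_mul_coeff_d_eq_zero`): a contradiction. -/

/-- If every edge inside `T` has weight at least `k`, then every monomial of `I(G)^s` supported in
`T` has weight at least `k * s`. -/
theorem le_weight_of_monomial_mem_edgeIdeal_pow {K V : Type*} [Field K] {G : SimpleGraph V}
    {s k : ℕ} (T : Set V) (w : V → ℕ)
    (hT : ∀ v ∈ T, ∀ v' ∈ T, G.Adj v v' → k ≤ w v + w v')
    {m : V →₀ ℕ} {r : K} (hr : r ≠ 0) (hm : monomial m r ∈ edgeIdeal K G ^ s)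
    (hmT : ∀ v, m v ≠ 0 → v ∈ T) : k * s ≤ m.sum fun v e => w v * e := by
  classical
  -- Setting the variables outside `T` to zero and the others to `X ^ w v` sends the edge ideal into
  -- `(X ^ k)`, and the monomial to `X` to its weight.
  let φ : MvPolynomial V K →ₐ[K] Polynomial K :=
    aeval fun v => if v ∈ T then (Polynomial.X : Polynomial K) ^ w v else 0
  have hI : (edgeIdeal K G).map φ.toRingHom ≤ Ideal.span {(Polynomial.X : Polynomial K) ^ k} := by
    rw [edgeIdeal, Ideal.map_span, Ideal.span_le]
    rintro _ ⟨_, ⟨v, v', hv, rfl⟩, rfl⟩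
    simp only [φ, AlgHom.toRingHom_eq_coe, RingHom.coe_coe, map_mul, aeval_X, SetLike.mem_coe]
    split_ifs with h h'
    · rw [← pow_add, Ideal.mem_span_singleton]
      exact pow_dvd_pow _ (hT v h v' h' hv)
    all_goals simp
  have hφ : φ (monomial m r) = Polynomial.C r * Polynomial.X ^ (m.sum fun v e => w v * e) := by
    simp only [φ, aeval_monomial, Polynomial.algebraMap_eq]
    congr 1
    rw [Finsupp.prod, Finsupp.sum, ← Finset.prod_pow_eq_pow_sum]
    refine Finset.prod_congr rfl fun v hv => ?_
    rw [if_pos (hmT v (Finsupp.mem_support_iff.1 hv)), pow_mul]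
  have h1 : φ (monomial m r) ∈ Ideal.span {(Polynomial.X : Polynomial K) ^ k} ^ s := by
    have := Ideal.mem_map_of_mem φ.toRingHom hm
    rw [Ideal.map_pow] at this
    exact Ideal.pow_right_mono hI s this
  rw [Ideal.span_singleton_pow, Ideal.mem_span_singleton, hφ, ← pow_mul,
    Polynomial.X_pow_dvd_iff] at h1
  by_contra! hlt
  have := h1 _ hlt
  simp [hr] at this

theorem IsMultihomogeneous.eq_monomial {σ K : Type*} [CommSemiring K] {p : MvPolynomial σ K}
    {m : σ →₀ ℕ} (hp : IsMultihomogeneous p fun v => (m v : ℤ)) : p = monomial m (coeff m p) := by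
  classical
  ext n
  rw [coeff_monomial]
  split_ifs with h
  · rw [h]
  · by_contra hn
    refine h (Finsupp.ext fun v => ?_)
    have : (n v : ℤ) = m v := hp n (mem_support_iff.2 hn) v
    exact_mod_cast this.symm

theorem IsMultihomogeneous.eq_of_coeff_ne_zero {σ K : Type*} [CommSemiring K]
    {p : MvPolynomial σ K} {a : σ → ℤ} (hp : IsMultihomogeneous p a) {m : σ →₀ ℕ}
    (hm : coeff m p ≠ 0) : a = fun v => (m v : ℤ) :=
  funext fun v => (hp m (mem_support_iff.2 hm) v).symm

theorem IsMultihomogeneous.exists_monomial {σ K : Type*} [CommSemiring K]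
    {p : MvPolynomial σ K} {a : σ → ℤ} (hp : IsMultihomogeneous p a) (h0 : p ≠ 0) :
    ∃ m r, r ≠ 0 ∧ p = monomial m r ∧ a = fun v => (m v : ℤ) := by
  obtain ⟨m, hm⟩ := exists_coeff_ne_zero h0
  have ha := hp.eq_of_coeff_ne_zero hm
  exact ⟨m, _, hm, (ha ▸ hp).eq_monomial, ha⟩

theorem eq_of_le_of_sum_le {V : Type*} [Fintype V] {m n : V →₀ ℕ} (h : m ≤ n)
    (hs : ∑ v, n v ≤ ∑ v, m v) : m = n := by
  have := (Finset.sum_eq_sum_iff_of_le fun v _ => h v).1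
    (le_antisymm (Finset.sum_le_sum fun v _ => h v) hs)
  exact Finsupp.ext fun v => this v (Finset.mem_univ v)

theorem two_mul_le_sum_of_monomial_mem {K V : Type*} [Field K] [Fintype V] {G : SimpleGraph V}
    {s : ℕ} {m : V →₀ ℕ} {r : K} (hr : r ≠ 0) (hm : monomial m r ∈ edgeIdeal K G ^ s) :
    2 * s ≤ ∑ v, m v := by
  have := le_weight_of_monomial_mem_edgeIdeal_pow (k := 2) Set.univ (fun _ => 1)
    (fun _ _ _ _ _ => le_rfl) hr hm (fun _ _ => Set.mem_univ _)
  rwa [Finsupp.sum_fintype _ _ (by simp), Finset.sum_congr rfl fun v _ => one_mul (m v)] at this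

/-- Each of the `s` edge factors contains `a`; the weight is the indicator of `a`. -/
theorem le_apply_of_monomial_mem {K V : Type*} [Field K] [Fintype V] {G : SimpleGraph V}
    {s : ℕ} (T : Set V) (a : V) (hT : ∀ v ∈ T, ∀ v' ∈ T, G.Adj v v' → v = a ∨ v' = a)
    {m : V →₀ ℕ} {r : K} (hr : r ≠ 0) (hm : monomial m r ∈ edgeIdeal K G ^ s)
    (hmT : ∀ v, m v ≠ 0 → v ∈ T) : s ≤ m a := by
  classical
  have := le_weight_of_monomial_mem_edgeIdeal_pow (k := 1) T (fun v => if v = a then 1 else 0)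
    (fun v hv v' hv' h => by rcases hT v hv v' hv' h with h | h <;> simp [h]) hr hm hmT
  rw [Finsupp.sum_fintype _ _ (by simp)] at this
  simpa using this

namespace MultigradedFreeResolution

variable {K V : Type*} [Field K]

theorem sum_deg_eq [Fintype V] {I : Ideal (MvPolynomial V K)} (F : MultigradedFreeResolution I)
    {d : ℤ} (hd : ∀ (i : ℕ) (t : ℤ), t ≠ d → F.betti i (i + t) = 0) (i : ℕ) (b : Fin (F.rank i)) :
    ∑ v, F.deg i b v = i + d := by
  by_contra h
  have := hd i (∑ v, F.deg i b v - i) (fun h' => h (by omega))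
  rw [betti, Finset.card_eq_zero, Finset.filter_eq_empty_iff] at this
  exact this (Finset.mem_univ b) (by ring)

theorem aug_apply {I : Ideal (MvPolynomial V K)} (F : MultigradedFreeResolution I)
    (f : Fin (F.rank 0) → MvPolynomial V K) :
    (F.aug f : MvPolynomial V K) = ∑ b, f b * (F.aug (Pi.single b 1) : MvPolynomial V K) := by
  conv_lhs => rw [pi_eq_sum_univ' f]
  simp [map_sum]

theorem d_apply {I : Ideal (MvPolynomial V K)} (F : MultigradedFreeResolution I) (i : ℕ)
    (f : Fin (F.rank (i + 1)) → MvPolynomial V K) (b : Fin (F.rank i)) :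
    F.d i f b = ∑ c, f c * F.d i (Pi.single c 1) b := by
  conv_lhs => rw [pi_eq_sum_univ' f]
  simp [map_sum]

/-- Every monomial of `I(G)^s` of the least possible degree `2 * s` is, up to a scalar, the image of
a basis element of `F_0`. -/
theorem exists_aug_single_eq [Fintype V] {G : SimpleGraph V} {s : ℕ}
    (F : MultigradedFreeResolution (edgeIdeal K G ^ s)) {n : V →₀ ℕ}
    (hn : monomial n (1 : K) ∈ edgeIdeal K G ^ s) (hdeg : ∑ v, n v = 2 * s) :
    ∃ (b : Fin (F.rank 0)) (r : K), r ≠ 0 ∧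
      (F.aug (Pi.single b 1) : MvPolynomial V K) = monomial n r ∧
      F.deg 0 b = fun v => (n v : ℤ) := by
  classical
  obtain ⟨f, hf⟩ := F.aug_surjective ⟨_, hn⟩
  have h1 : coeff n (F.aug f : MvPolynomial V K) ≠ 0 := by simp [hf]
  rw [aug_apply, coeff_sum] at h1
  obtain ⟨b, -, hb⟩ := Finset.exists_ne_zero_of_sum_ne_zero h1
  have h0 : (F.aug (Pi.single b 1) : MvPolynomial V K) ≠ 0 := by
    intro h
    simp [h] at hb
  obtain ⟨m, r, hr, hmr, hdm⟩ := (F.aug_graded b).exists_monomial h0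
  have hmem : monomial m r ∈ edgeIdeal K G ^ s := hmr ▸ (F.aug (Pi.single b 1)).2
  rw [hmr, coeff_mul_monomial'] at hb
  have hle : m ≤ n := by
    by_contra h
    simp [h] at hb
  obtain rfl := eq_of_le_of_sum_le hle (hdeg.trans_le (two_mul_le_sum_of_monomial_mem hr hmem))
  exact ⟨b, r, hr, hmr, hdm⟩

/-- A linear syzygy of multidegree `n + x`, where `n = (ab)^s`, has no component along the basis
elements of multidegree `n`, when `ab` is the only edge on `{a, b, x}`. -/
theorem sum_coeff_aug_mul_coeff_d_eq_zero [Fintype V] {G : SimpleGraph V} {s : ℕ}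
    (F : MultigradedFreeResolution (edgeIdeal K G ^ s)) (h0 : ∀ b, ∑ v, F.deg 0 b v = 2 * s)
    {a b x : V} (hab : a ≠ b) (hax : ¬ G.Adj a x) (hbx : ¬ G.Adj b x)
    (e : Fin (F.rank 1)) :
    ∑ i, coeff (Finsupp.single a s + Finsupp.single b s)
        (F.aug (Pi.single i 1) : MvPolynomial V K) *
      coeff (Finsupp.single x 1) (F.d 0 (Pi.single e 1) i) = 0 := by
  classical
  -- Read off the coefficient of `n + x` in the image of the syzygy, which is zero; only basis
  -- elements mapping to multiples of `n` will contribute.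
  set n := Finsupp.single a s + Finsupp.single b s with hn
  have hsyz : F.aug (F.d 0 (Pi.single e 1)) = 0 := F.exact_zero.apply_apply_eq_zero _
  have hco : coeff (n + Finsupp.single x 1)
      (F.aug (F.d 0 (Pi.single e 1)) : MvPolynomial V K) = 0 := by rw [hsyz]; simp
  rw [aug_apply, coeff_sum] at hco
  rw [← hco]
  refine Finset.sum_congr rfl fun i _ => ?_
  by_cases hz : (F.aug (Pi.single i 1) : MvPolynomial V K) = 0
  · simp [hz]
  obtain ⟨m, r, hr, hmr, hdm⟩ := (F.aug_graded i).exists_monomial hz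
  have hmem : monomial m r ∈ edgeIdeal K G ^ s := hmr ▸ (F.aug (Pi.single i 1)).2
  rw [hmr, coeff_mul_monomial', coeff_monomial]
  by_cases hmn : m = n
  · simp [hmn, mul_comm]
  rw [if_neg hmn, zero_mul, if_neg]
  intro hle
  have hT : ∀ v, m v ≠ 0 → v ∈ ({a, b, x} : Set V) := by
    intro v hv
    have h1 := hle v
    by_contra h2
    simp only [Set.mem_insert_iff, Set.mem_singleton_iff, not_or] at h2
    simp [hn, Ne.symm h2.1, Ne.symm h2.2.1, Ne.symm h2.2.2] at h1
    exact hv h1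
  have hxa : ¬ G.Adj x a := fun h => hax h.symm
  have hxb : ¬ G.Adj x b := fun h => hbx h.symm
  -- Inside `{a, b, x}` every edge is `ab`, so `n ≤ m`; equal degrees then force `m = n`.
  have ha : s ≤ m a := by
    refine le_apply_of_monomial_mem {a, b, x} a ?_ hr hmem hT
    rintro v (rfl | rfl | rfl) v' (rfl | rfl | rfl) h <;> simp_all
  have hb : s ≤ m b := by
    refine le_apply_of_monomial_mem {a, b, x} b ?_ hr hmem hT
    rintro v (rfl | rfl | rfl) v' (rfl | rfl | rfl) h <;> simp_all
  refine hmn (eq_of_le_of_sum_le (fun v => ?_) ?_).symm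
  · by_cases hva : v = a
    · subst hva
      simpa [hn, hab.symm] using ha
    by_cases hvb : v = b
    · subst hvb
      simpa [hn, hab] using hb
    simp [hn, Ne.symm hva, Ne.symm hvb]
  · have h1 : ∑ v, (m v : ℤ) = 2 * s := by simpa only [hdm] using h0 i
    have h2 : ∑ v, n v = 2 * s := by
      simp [hn, Finset.sum_add_distrib, Finsupp.single_apply, two_mul]
    rw [h2]
    exact_mod_cast h1.le

end MultigradedFreeResolution

open MultigradedFreeResolution in
/-- Powers of the edge ideal of a graph with two disjoint edges spanning an induced `2K₂` do not
have a linear resolution. -/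
theorem not_hasLinearResolution_of_induced_pair {K V : Type*} [Field K] [Fintype V]
    {G : SimpleGraph V} {a b x y : V} (hab : G.Adj a b) (hxy : G.Adj x y)
    (hax : ¬ G.Adj a x) (hay : ¬ G.Adj a y) (hbx : ¬ G.Adj b x) (hby : ¬ G.Adj b y)
    {s : ℕ} (hs : 1 ≤ s) : ¬ HasLinearResolution (edgeIdeal K G ^ s) := by
  classical
  rintro ⟨F, -, d, hd⟩
  obtain ⟨s, rfl⟩ : ∃ k, s = k + 1 := ⟨s - 1, by omega⟩
  have hne : a ≠ b := hab.ne
  have hxa : x ≠ a := by rintro rfl; exact hbx hab.symm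
  have hya : y ≠ a := by rintro rfl; exact hby hab.symm
  set u : V →₀ ℕ := Finsupp.single a 1 + Finsupp.single b 1 with hu
  set w : V →₀ ℕ := Finsupp.single x 1 + Finsupp.single y 1 with hw
  have hX (p q : V) : (monomial (Finsupp.single p 1 + Finsupp.single q 1) (1 : K)) = X p * X q := by
    simp [X, monomial_mul]
  have huI : monomial u (1 : K) ∈ edgeIdeal K G :=
    Ideal.subset_span ⟨a, b, hab, hX a b⟩
  have hwI : monomial w (1 : K) ∈ edgeIdeal K G :=
    Ideal.subset_span ⟨x, y, hxy, hX x y⟩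
  set n : V →₀ ℕ := Finsupp.single a (s + 1) + Finsupp.single b (s + 1) with hn
  have hnu : n = (s + 1) • u := by simp [hn, hu]
  have hsu : ∑ v, u v = 2 := by simp [hu, Finset.sum_add_distrib, Finsupp.single_apply]
  have hsw : ∑ v, w v = 2 := by simp [hw, Finset.sum_add_distrib, Finsupp.single_apply]
  have hwu : w ≠ u := by
    intro h
    have := DFunLike.congr_fun h a
    simp [hw, hu, hxa, hya, hne.symm] at this
  obtain ⟨b₀, r₀, hr₀, hb₀, hdeg₀⟩ := F.exists_aug_single_eq (n := n)
    (by
      have := Ideal.pow_mem_pow huI (s + 1)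
      rwa [monomial_pow, one_pow, ← hnu] at this)
    (by simp [hnu, ← Finset.mul_sum, hsu, mul_comm])
  obtain ⟨b₁, r₁, hr₁, hb₁, -⟩ := F.exists_aug_single_eq (n := s • u + w)
    (by
      have := Ideal.mul_mem_mul (Ideal.pow_mem_pow huI s) hwI
      rwa [monomial_pow, one_pow, monomial_mul, one_mul, ← pow_succ] at this)
    (by simp [Finset.sum_add_distrib, ← Finset.mul_sum, hsu, hsw]; ring)
  have hdeg : d = 2 * (s + 1) := by
    have h1 := F.sum_deg_eq hd 0 b₀
    rw [hdeg₀] at h1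
    have h2 : ∑ v, n v = 2 * (s + 1) := by simp [hnu, ← Finset.mul_sum, hsu, mul_comm]
    have h3 : ((∑ v, n v : ℕ) : ℤ) = d := by push_cast; simpa using h1
    rw [← h3, h2]; push_cast; ring
  have h0 : ∀ i, ∑ v, F.deg 0 i v = 2 * ((s + 1 : ℕ) : ℤ) := fun i => by
    rw [F.sum_deg_eq hd 0 i, hdeg]; push_cast; ring
  -- The scalars are crossed so that the two images cancel.
  set z : Fin (F.rank 0) → MvPolynomial V K :=
    Pi.single b₀ (monomial w r₁) - Pi.single b₁ (monomial u r₀) with hz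
  have hsingle (i : Fin (F.rank 0)) (p : MvPolynomial V K) :
      (F.aug (Pi.single i p) : MvPolynomial V K) = p * F.aug (Pi.single i 1) := by
    rw [show (Pi.single i p : Fin (F.rank 0) → MvPolynomial V K) = p • Pi.single i 1 by
      rw [← Pi.single_smul, smul_eq_mul, mul_one], map_smul, Submodule.coe_smul, smul_eq_mul]
  have hzker : F.aug z = 0 := by
    apply Subtype.ext
    rw [hz, map_sub, Submodule.coe_sub, hsingle b₀, hsingle b₁, hb₀, hb₁, monomial_mul,
      monomial_mul, ZeroMemClass.coe_zero, hnu, mul_comm r₁,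
      show w + (s + 1) • u = u + (s • u + w) by rw [succ_nsmul]; abel, sub_self]
  obtain ⟨q, hq⟩ := (F.exact_zero z).1 hzker
  -- This functional extracts the coefficient of `w` along multidegree `n`; summing allows for
  -- several basis elements of that multidegree.
  have hψz : ∑ i, coeff n (F.aug (Pi.single i 1) : MvPolynomial V K) * coeff w (z i) = r₀ * r₁ := by
    have hbb : coeff n (F.aug (Pi.single b₁ 1) : MvPolynomial V K) = 0 := by
      rw [hb₁, coeff_monomial, if_neg]
      rw [hnu, succ_nsmul]
      exact fun h => hwu (add_left_cancel h)
    rw [Finset.sum_eq_single b₀]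
    · rw [hb₀, hz]
      by_cases hbe : b₀ = b₁
      · subst hbe
        rw [hb₀] at hbb
        simp at hbb
        exact absurd hbb hr₀
      · simp [hbe]
    · intro i _ hi
      by_cases hi1 : i = b₁
      · rw [hi1, hbb, zero_mul]
      · simp [hz, hi, hi1]
    · simp
  refine mul_ne_zero hr₀ hr₁ (hψz.symm.trans ?_)
  rw [← hq]
  simp_rw [d_apply F 0 q, coeff_sum, Finset.mul_sum]
  rw [Finset.sum_comm]
  refine Finset.sum_eq_zero fun e _ => ?_
  -- Along multidegree `n` the syzygy `e` has scalar multiples of the variable `p` as entries, so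
  -- the coefficient of `p'` in `q e` factors out of the sum.
  have key : ∀ p p' : V, w = Finsupp.single p 1 + Finsupp.single p' 1 →
      ¬ G.Adj a p → ¬ G.Adj b p →
      (F.deg 1 e = fun v => ((n + Finsupp.single p 1 : V →₀ ℕ) v : ℤ)) →
      ∑ i, coeff n (F.aug (Pi.single i 1) : MvPolynomial V K) *
        coeff w (q e * F.d 0 (Pi.single e 1) i) = 0 := by
    intro p p' hwp hap hbp hde
    have := F.sum_coeff_aug_mul_coeff_d_eq_zero h0 hne hap hbp e
    rw [← mul_zero (coeff (Finsupp.single p' 1) (q e)), ← this, Finset.mul_sum]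
    refine Finset.sum_congr rfl fun i _ => ?_
    by_cases hi : coeff n (F.aug (Pi.single i 1) : MvPolynomial V K) = 0
    · rw [← hn, hi]; simp
    have hdi := (F.aug_graded i).eq_of_coeff_ne_zero hi
    have hD := F.d_graded 0 e i
    have hD' : IsMultihomogeneous (F.d 0 (Pi.single e 1) i)
        (fun v => ((Finsupp.single p 1 : V →₀ ℕ) v : ℤ)) := by
      convert hD using 1
      rw [hdi]
      funext v
      have := congrFun hde v
      simp only [Pi.sub_apply, this, Finsupp.add_apply, Nat.cast_add,
        add_sub_cancel_left]
    rw [hD'.eq_monomial, hwp, add_comm (Finsupp.single p 1), coeff_mul_monomial, coeff_monomial,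
      if_pos rfl, ← hn]
    ring
  -- A nonzero term yields an entry of degree 1, by linearity, dividing `w`: the variable `x` or
  -- `y`.
  by_contra hne0
  obtain ⟨i, -, hi⟩ := Finset.exists_ne_zero_of_sum_ne_zero hne0
  have hdi := (F.aug_graded i).eq_of_coeff_ne_zero (left_ne_zero_of_mul hi)
  obtain ⟨m, r, hr, hm, hdm⟩ := (F.d_graded 0 e i).exists_monomial
    (p := F.d 0 (Pi.single e 1) i) (by intro h; simp [h] at hi)
  rw [hm, coeff_mul_monomial'] at hi
  have hle : m ≤ w := by
    by_contra h
    simp [h] at hi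
  have hsm : ∑ v, m v = 1 := by
    have h1 : ∑ v, (F.deg (0 + 1) e - F.deg 0 i) v = 1 := by
      simp only [Pi.sub_apply, Finset.sum_sub_distrib]
      rw [F.sum_deg_eq hd, F.sum_deg_eq hd]
      push_cast
      ring
    replace h1 : ∑ v, (m v : ℤ) = 1 := by simpa only [hdm] using h1
    exact_mod_cast h1
  obtain ⟨p, hp⟩ : ∃ p, m = Finsupp.single p 1 := by
    obtain ⟨p, -, hp⟩ := Finset.exists_ne_zero_of_sum_ne_zero (hsm.trans_ne one_ne_zero)
    refine ⟨p, (eq_of_le_of_sum_le ?_ ?_).symm⟩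
    · simpa [Finsupp.single_le_iff] using Nat.one_le_iff_ne_zero.2 hp
    · rw [hsm]; simp [Finsupp.single_apply]
  have hde : F.deg 1 e = fun v => ((n + Finsupp.single p 1 : V →₀ ℕ) v : ℤ) := by
    funext v
    have := congrFun hdm v
    rw [hdi, hp] at this
    simp only [Pi.sub_apply] at this
    simp only [Finsupp.add_apply, Nat.cast_add]
    linarith
  have hp' : p = x ∨ p = y := by
    have h1 := hle p
    by_contra! h2
    simp [hp, hw, Ne.symm h2.1, Ne.symm h2.2] at h1
  rcases hp' with rfl | rfl
  · exact hne0 (key _ _ hw hax hbx hde)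
  · exact hne0 (key _ _ (hw.trans (add_comm _ _)) hay hby hde)

theorem corollary2p4 {K V : Type*} [Field K] [Fintype V] (G : SimpleGraph V) (s : ℕ) (hs : 1 ≤ s)
    (hlin : HasLinearResolution (edgeIdeal K G ^ s)) :
    ¬ (SimpleGraph.cycleGraph 4).IsIndContained Gᶜ := by
  rintro ⟨f⟩
  have hadj (i j : Fin 4) (hij : i ≠ j) (h : ¬ (SimpleGraph.cycleGraph 4).Adj i j) :
      G.Adj (f i) (f j) := by
    rw [← f.map_adj_iff, SimpleGraph.compl_adj] at h
    by_contra h'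
    exact h ⟨f.injective.ne hij, h'⟩
  have hnadj (i j : Fin 4) (h : (SimpleGraph.cycleGraph 4).Adj i j) : ¬ G.Adj (f i) (f j) := by
    rw [← f.map_adj_iff, SimpleGraph.compl_adj] at h
    exact h.2
  -- The two diagonals of the 4-cycle are the edges of G.
  exact not_hasLinearResolution_of_induced_pair (hadj 0 2 (by decide) (by decide))
    (hadj 1 3 (by decide) (by decide)) (hnadj 0 1 (by decide)) (hnadj 0 3 (by decide))
    (hnadj 2 1 (by decide)) (hnadj 2 3 (by decide)) hs hlin
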